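/- Let $p$ be a prime with $p \equiv 1$ or $p \equiv -1 \pmod 8$, and let $M, N$ be integers with $p = M^2 + 7N^2$ such that $M \equiv 1 \pmod 4$ or $N \equiv 1 \pmod 4$. Then (a) there exist integers $A, B$ with $p = A^2 + 14B^2$ if and only if $2p + M + N \equiv 3 \pmod 8$; (b) there exist integers $C, D$ with $p = 7C^2 + 2D^2$ if and only if $2p + M + N \equiv 7 \pmod 8$. -/

import Mathlib

/-! By genus theory `p` is represented by `x² + 14y²` or `7x² + 2y²` (Thue's lemma). The residues 3
and 7 are distinct, so it suffices that each representation forces its residue. Comparing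
representations gives `(A + M)(A - M) = 7(N² - 2B²)` or `7(C + N)(C - N) = M² - 2D²`; the right
sides are norms from `ℤ[√2]`, as `7 = 3² - 2·1²`. Primes `≡ ±3 (mod 8)` are inert there, and one
shared by both factors would have its square dividing `p`. So the odd part of `A + M` or `C + N` is
`±1` modulo 8, which determines `M + N` modulo 8. -/

/-- A prime `q ≡ ±3 (mod 8)` is inert in `ℤ[√2]`: it divides `s ^ 2 - 2 * t ^ 2` only if it divides
both `s` and `t`. -/
theorem Int.dvd_and_dvd_of_dvd_sq_sub_two_mul_sq {q : ℕ} (hq : q.Prime)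
    (hq8 : q % 8 = 3 ∨ q % 8 = 5) {s t : ℤ} (h : (q : ℤ) ∣ s ^ 2 - 2 * t ^ 2) :
    (q : ℤ) ∣ s ∧ (q : ℤ) ∣ t := by
  have := Fact.mk hq
  have hq2 : q ≠ 2 := by omega
  have hz : ((s : ZMod q)) ^ 2 - 2 * (t : ZMod q) ^ 2 = 0 := by
    have := (ZMod.intCast_zmod_eq_zero_iff_dvd _ q).2 h
    exact_mod_cast this
  have ht : (t : ZMod q) = 0 := by
    by_contra ht
    have : IsSquare (2 : ZMod q) := ⟨s / t, by field_simp; linear_combination -hz⟩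
    rw [ZMod.exists_sq_eq_two_iff hq2] at this
    omega
  have hs : (s : ZMod q) = 0 := by
    rw [ht] at hz
    exact pow_eq_zero_iff two_ne_zero |>.1 (by linear_combination hz)
  exact ⟨(ZMod.intCast_zmod_eq_zero_iff_dvd _ q).1 hs, (ZMod.intCast_zmod_eq_zero_iff_dvd _ q).1 ht⟩

/-- An odd divisor of a norm `s ^ 2 - 2 * t ^ 2` sharing no prime `≡ ±3 (mod 8)` with its cofactor
is `≡ ±1 (mod 8)`. -/
theorem Int.emod_eight_of_mul_eq_sq_sub_two_mul_sq (u w s t : ℤ) (hu : u % 2 = 1)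
    (h : u * w = s ^ 2 - 2 * t ^ 2)
    (hc : ∀ q : ℕ, q.Prime → (q % 8 = 3 ∨ q % 8 = 5) → (q : ℤ) ∣ u → ¬ (q : ℤ) ∣ w) :
    u % 8 = 1 ∨ u % 8 = 7 := by
  induction hn : u.natAbs using Nat.strong_induction_on generalizing u w s t with
  | _ n ih =>
  subst hn
  by_cases h1 : u.natAbs = 1
  · omega
  obtain ⟨q, hq, hqu⟩ := Nat.exists_prime_and_dvd h1
  obtain ⟨v, rfl⟩ := Int.natCast_dvd.2 hqu
  have hvodd : v % 2 = 1 := by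
    rcases Int.emod_two_eq_zero_or_one v with hv | hv
    · rw [Int.mul_emod, hv] at hu; simp at hu
    · exact hv
  have hqodd : (q : ℤ) % 2 = 1 := by
    rcases Int.emod_two_eq_zero_or_one (q : ℤ) with hv | hv
    · rw [Int.mul_emod, hv] at hu; simp at hu
    · exact hv
  have hvpos : 0 < v.natAbs := by omega
  have hq8 : (q % 8 = 1 ∨ q % 8 = 7) ∨ (q % 8 = 3 ∨ q % 8 = 5) := by omega
  rcases hq8 with hq8 | hq8
  -- A prime `≡ ±1 (mod 8)` is harmless, so it moves into the cofactor.
  · have hv := ih v.natAbs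
      (by rw [Int.natAbs_mul, Int.natAbs_natCast]; nlinarith [hq.two_le]) v (q * w) s t hvodd
      (by linear_combination h)
      (fun r hr hr8 hrv hrw => by
        rcases (Nat.prime_iff_prime_int.1 hr).dvd_or_dvd hrw with h' | h'
        · have := (Nat.prime_dvd_prime_iff_eq hr hq).1 (by exact_mod_cast h')
          omega
        · exact hc r hr hr8 (hrv.mul_left _) h') rfl
    have hq8' : (q : ℤ) % 8 = 1 ∨ (q : ℤ) % 8 = 7 := by omega
    rw [Int.mul_emod]
    rcases hv with hv | hv <;> rcases hq8' with h' | h' <;> simp [hv, h']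
  · obtain ⟨⟨s', rfl⟩, ⟨t', rfl⟩⟩ := Int.dvd_and_dvd_of_dvd_sq_sub_two_mul_sq hq hq8
      (s := s) (t := t) (by rw [← h, mul_assoc]; exact dvd_mul_right _ _)
    have hq0 : (q : ℤ) ≠ 0 := by exact_mod_cast hq.ne_zero
    have h' : v * w = q * (s' ^ 2 - 2 * t' ^ 2) :=
      mul_left_cancel₀ hq0 (by linear_combination h)
    obtain ⟨v', rfl⟩ : (q : ℤ) ∣ v :=
      ((Nat.prime_iff_prime_int.1 hq).dvd_or_dvd (Dvd.intro _ h'.symm)).resolve_right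
        (hc q hq hq8 (Dvd.intro _ rfl))
    have h'' : v' * w = s' ^ 2 - 2 * t' ^ 2 := mul_left_cancel₀ hq0 (by linear_combination h')
    have hv'odd : v' % 2 = 1 := by
      rcases Int.emod_two_eq_zero_or_one v' with hv | hv
      · rw [Int.mul_emod, hv] at hvodd; simp at hvodd
      · exact hv
    have hv := ih v'.natAbs
      (by
        have : 0 < v'.natAbs := by omega
        simp only [Int.natAbs_mul, Int.natAbs_natCast]
        nlinarith [hq.two_le, Nat.mul_le_mul_right v'.natAbs (Nat.mul_le_mul hq.two_le hq.two_le)])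
      v' w s' t' hv'odd h''
      (fun r hr hr8 hrv => hc r hr hr8 ((hrv.mul_left _).mul_left _)) rfl
    have hq8' : (q : ℤ) % 8 = 3 ∨ (q : ℤ) % 8 = 5 := by omega
    rw [← mul_assoc, Int.mul_emod, Int.mul_emod (q : ℤ) q]
    rcases hv with hv | hv <;> rcases hq8' with h' | h' <;> simp [hv, h']

/-! ### Congruences modulo 8 and 16 -/

theorem Int.add_four_mul_emod_eight {u w n b : ℤ} (hu : u % 8 = 1 ∨ u % 8 = 7)
    (h : u * w ≡ 7 * (2 * n ^ 2 - b ^ 2) [ZMOD 8]) (hM : (u - 2 * w) % 4 = 1) :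
    (u - 2 * w + 4 * n) % 8 = 1 := by
  have key : ∀ u w n b : ZMod 8, (u = 1 ∨ u = 7) → u * w = 7 * (2 * n ^ 2 - b ^ 2) →
      (u - 2 * w = 1 ∨ u - 2 * w = 5) → u - 2 * w + 4 * n = 1 := by
    rintro u w n b (rfl | rfl) <;> revert w n b <;> decide
  have cast : ∀ x y : ℤ, x % 8 = y % 8 ↔ (x : ZMod 8) = y := fun x y =>
    (ZMod.intCast_eq_intCast_iff x y 8).symm
  have h1 := key u w n b
    (hu.imp (fun h => by exact_mod_cast (cast u 1).1 h) (fun h => by exact_mod_cast (cast u 7).1 h))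
    (by exact_mod_cast (cast _ _).1 h)
    (by
      have : (u - 2 * w) % 8 = 1 ∨ (u - 2 * w) % 8 = 5 := by omega
      exact this.imp (fun h => by exact_mod_cast (cast (u - 2 * w) 1).1 h)
        (fun h => by exact_mod_cast (cast (u - 2 * w) 5).1 h))
  exact (cast (u - 2 * w + 4 * n) 1).2 (by exact_mod_cast h1)

theorem Int.sq_emod_sixteen_of_odd {x : ℤ} (hx : x % 2 = 1) :
    (x % 8 = 1 ∨ x % 8 = 7) ∧ x ^ 2 % 16 = 1 ∨ (x % 8 = 3 ∨ x % 8 = 5) ∧ x ^ 2 % 16 = 9 := by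
  obtain ⟨k, r, hr, hr', rfl⟩ : ∃ k r : ℤ, 0 ≤ r ∧ r < 8 ∧ x = 8 * k + r :=
    ⟨x / 8, x % 8, by omega, by omega, by omega⟩
  have : (8 * k + r) ^ 2 = 16 * (4 * k ^ 2 + k * r) + r ^ 2 := by ring
  rw [this]
  interval_cases r <;> omega

theorem Int.add_emod_eight_eq_five {A B M N : ℤ} (hM : M % 4 = 0) (hN : N % 4 = 1)
    (hA : (A + M) % 8 = 1 ∨ (A + M) % 8 = 7) (hB : B % 2 = 1)
    (h : A ^ 2 + 14 * B ^ 2 ≡ M ^ 2 + 7 * N ^ 2 [ZMOD 16]) : (M + N) % 8 = 5 := by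
  have hM2 : M ^ 2 % 16 = 0 := by
    obtain ⟨k, rfl⟩ : ∃ k, M = 4 * k := ⟨M / 4, by omega⟩
    rw [show (4 * k) ^ 2 = 16 * k ^ 2 by ring]; omega
  have hA2 := Int.sq_emod_sixteen_of_odd (x := A) (by omega)
  have hB2 := Int.sq_emod_sixteen_of_odd hB
  have hN2 := Int.sq_emod_sixteen_of_odd (x := N) (by omega)
  unfold Int.ModEq at h
  omega

/-! ### Representation by the principal genus -/

/-- Thue's lemma with bounds adapted to the form `x ^ 2 + 14 * y ^ 2`. -/
theorem exists_sq_add_fourteen_mul_sq_eq_mul {p : ℕ} [Fact p.Prime] (r : ZMod p)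
    (hr : r ^ 2 = -14) :
    ∃ x y k : ℤ, x ^ 2 + 14 * y ^ 2 = k * p ∧ 0 < k ∧ k ≤ 7 := by
  have hp : 0 < p := (Fact.out : p.Prime).pos
  -- The box `x² ≤ 4p`, `y² ≤ p/4` gives `x² + 14y² ≤ 7.5p`, hence `k ≤ 7`.
  set X := Nat.sqrt (4 * p)
  set Y := Nat.sqrt (p / 4)
  have hX : X * X ≤ 4 * p := Nat.sqrt_le _
  have hX' : 4 * p < (X + 1) * (X + 1) := Nat.lt_succ_sqrt _
  have hY : Y * Y ≤ p / 4 := Nat.sqrt_le _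
  have hY' : p / 4 < (Y + 1) * (Y + 1) := Nat.lt_succ_sqrt _
  have hY4 : 4 * (Y * Y) ≤ p := by omega
  have hY4' : p < 4 * ((Y + 1) * (Y + 1)) := by omega
  have hcard : p < (X + 1) * (Y + 1) := by
    by_contra! hle
    have h1 := Nat.mul_lt_mul'' hX' hY4'
    have h2 := Nat.mul_le_mul hle hle
    nlinarith
  obtain ⟨a, ha, b, hb, hab, hf⟩ := Finset.exists_ne_map_eq_of_card_lt_of_maps_to
    (s := Finset.range (X + 1) ×ˢ Finset.range (Y + 1)) (t := (Finset.univ : Finset (ZMod p)))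
    (f := fun a => (a.1 : ZMod p) - r * a.2)
    (by simpa [ZMod.card] using hcard) (fun _ _ => Finset.mem_coe.2 (Finset.mem_univ _))
  simp only [Finset.mem_product, Finset.mem_range] at ha hb
  obtain ⟨x, hx⟩ : ∃ x : ℤ, x = a.1 - b.1 := ⟨_, rfl⟩
  obtain ⟨y, hy⟩ : ∃ y : ℤ, y = a.2 - b.2 := ⟨_, rfl⟩
  have hdvd : (p : ℤ) ∣ x ^ 2 + 14 * y ^ 2 := by
    rw [← ZMod.intCast_zmod_eq_zero_iff_dvd, hx, hy]
    push_cast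
    have hxy : (a.1 : ZMod p) - b.1 = r * (a.2 - b.2) := by linear_combination hf
    rw [hxy]
    linear_combination ((a.2 : ZMod p) - b.2) ^ 2 * hr
  obtain ⟨k, hk⟩ := hdvd
  have hx2 : x ^ 2 ≤ 4 * p := by
    have : x ^ 2 ≤ (X : ℤ) ^ 2 := sq_le_sq' (by omega) (by omega)
    have : (X : ℤ) * X ≤ 4 * p := by exact_mod_cast hX
    nlinarith
  have hy2 : 4 * y ^ 2 ≤ p := by
    have : y ^ 2 ≤ (Y : ℤ) ^ 2 := sq_le_sq' (by omega) (by omega)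
    have : 4 * ((Y : ℤ) * Y) ≤ p := by exact_mod_cast hY4
    nlinarith
  have hpos : 0 < x ^ 2 + 14 * y ^ 2 := by
    by_cases hx0 : x = 0
    · have hy0 : y ≠ 0 := by
        intro hy0
        exact hab (Prod.ext (by omega) (by omega))
      positivity
    · positivity
  have hpZ : (0 : ℤ) < p := by exact_mod_cast hp
  refine ⟨x, y, k, by rw [hk]; ring, ?_, ?_⟩
  · exact pos_of_mul_pos_right (hk ▸ hpos) hpZ.le
  · by_contra! hk8
    nlinarith

theorem Nat.Prime.not_natCast_sq_dvd {p : ℕ} (hp : p.Prime) {q : ℕ} (hq : q.Prime) :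
    ¬ (q : ℤ) ^ 2 ∣ (p : ℤ) := by
  intro h
  have h' : q ^ 2 ∣ p := by exact_mod_cast h
  have := (Nat.prime_dvd_prime_iff_eq hq hp).1 (dvd_trans (dvd_pow_self q two_ne_zero) h')
  subst this
  have := Nat.le_of_dvd hp.pos h'
  nlinarith [hp.two_le]

/-- A prime `p ≡ ±1 (mod 8)` of the form `M ^ 2 + 7 * N ^ 2` is represented by a form in the
principal genus of discriminant `-56`. -/
theorem exists_sq_add_fourteen_mul_sq_or {p : ℕ} (hp : p.Prime) (hp8 : p % 8 = 1 ∨ p % 8 = 7)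
    {M N : ℤ} (h : (p : ℤ) = M ^ 2 + 7 * N ^ 2) :
    (∃ A B : ℤ, (p : ℤ) = A ^ 2 + 14 * B ^ 2) ∨ ∃ C D : ℤ, (p : ℤ) = 7 * C ^ 2 + 2 * D ^ 2 := by
  have := Fact.mk hp
  by_cases h7 : p = 7
  · exact Or.inr ⟨1, 0, by simp [h7]⟩
  have hp2 : p ≠ 2 := by omega
  obtain ⟨s, hs⟩ := (ZMod.exists_sq_eq_two_iff hp2).2 hp8
  have hz : (M : ZMod p) ^ 2 + 7 * (N : ZMod p) ^ 2 = 0 := by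
    have := congrArg (Int.cast : ℤ → ZMod p) h
    push_cast at this
    rw [← this]; simp
  have hN : (N : ZMod p) ≠ 0 := by
    intro hN
    rw [hN] at hz
    have hM : (M : ZMod p) = 0 := pow_eq_zero_iff two_ne_zero |>.1 (by linear_combination hz)
    obtain ⟨a, ha⟩ := (ZMod.intCast_zmod_eq_zero_iff_dvd _ p).1 hM
    obtain ⟨b, hb⟩ := (ZMod.intCast_zmod_eq_zero_iff_dvd _ p).1 hN
    exact hp.not_natCast_sq_dvd hp ⟨a ^ 2 + 7 * b ^ 2,
      by linear_combination h + (M + p * a) * ha + 7 * (N + p * b) * hb⟩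
  -- `(M/N)² = -7` and `s² = 2`, so the product is a square root of `-14`.
  obtain ⟨x, y, k, hk, hk0, hk7⟩ := exists_sq_add_fourteen_mul_sq_eq_mul (M / N * s : ZMod p) (by
    field_simp
    linear_combination (-(M : ZMod p) ^ 2) * hs + 2 * hz)
  have hM7 : M % 7 ≠ 0 := by
    intro hM
    obtain ⟨m, rfl⟩ : ∃ m, M = 7 * m := ⟨M / 7, by omega⟩
    have : (7 : ℤ) ∣ p := ⟨7 * m ^ 2 + N ^ 2, by rw [h]; ring⟩
    exact h7 ((Nat.prime_dvd_prime_iff_eq (by norm_num) hp).1 (by exact_mod_cast this)).symm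
  -- Modulo 7, `kp` and `p ≡ M² ≠ 0` are squares, so `k` is not a nonresidue.
  have hk7' : k = 1 ∨ k = 2 ∨ k = 4 ∨ k = 7 := by
    have key : ∀ k m x : ZMod 7, (k = 3 ∨ k = 5 ∨ k = 6) → x ^ 2 = k * m ^ 2 → m = 0 := by decide
    by_contra hne
    have hk356 : k = 3 ∨ k = 5 ∨ k = 6 := by omega
    refine hM7 (Int.emod_eq_zero_of_dvd ((ZMod.intCast_zmod_eq_zero_iff_dvd M 7).1
      (key k M x ?_ ?_)))
    · rcases hk356 with rfl | rfl | rfl <;> simp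
    · have e := congrArg (Int.cast : ℤ → ZMod 7) hk
      have e14 : (14 : ZMod 7) = 0 := by decide
      have e7 : (7 : ZMod 7) = 0 := by decide
      rw [h] at e
      push_cast at e
      linear_combination e - (y : ZMod 7) ^ 2 * e14 + k * (N : ZMod 7) ^ 2 * e7
  have even_of_sq : ∀ z : ℤ, Even (z ^ 2) → ∃ c, z = 2 * c := fun z hz =>
    (even_iff_two_dvd.1 ((Int.even_pow' two_ne_zero).1 hz))
  rcases hk7' with rfl | rfl | rfl | rfl
  · exact Or.inl ⟨x, y, by linear_combination -hk⟩
  · obtain ⟨c, rfl⟩ := even_of_sq x ⟨p - 7 * y ^ 2, by linear_combination hk⟩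
    exact Or.inr ⟨y, c, by linarith⟩
  · obtain ⟨c, rfl⟩ := even_of_sq x ⟨2 * p - 7 * y ^ 2, by linear_combination hk⟩
    obtain ⟨d, rfl⟩ := even_of_sq y ⟨p - 3 * y ^ 2 - c ^ 2, by linarith⟩
    exact Or.inl ⟨c, d, by linarith⟩
  · have : (7 : ℤ) ∣ x ^ 2 := ⟨p - 2 * y ^ 2, by linear_combination hk⟩
    obtain ⟨c, rfl⟩ := (show Prime (7 : ℤ) by norm_num).dvd_of_dvd_pow this
    exact Or.inr ⟨c, y, by linarith⟩

/-! ### Each representation forces its residue -/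

/-- Residues of `M` and `N` for an odd `M ^ 2 + 7 * N ^ 2 ≡ ±1 (mod 8)`. -/
theorem Int.emod_of_sq_add_seven_mul_sq {p M N : ℤ} (hp8 : p % 8 = 1 ∨ p % 8 = 7)
    (h : p = M ^ 2 + 7 * N ^ 2) (hMN : M % 4 = 1 ∨ N % 4 = 1) :
    p % 8 = 1 ∧ M % 4 = 1 ∧ N % 4 = 0 ∨ p % 8 = 7 ∧ M % 4 = 0 ∧ N % 4 = 1 := by
  have sq : ∀ x : ℤ, x % 2 = 1 ∧ x ^ 2 % 8 = 1 ∨ x % 4 = 2 ∧ x ^ 2 % 8 = 4 ∨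
      x % 4 = 0 ∧ x ^ 2 % 8 = 0 := by
    intro x
    obtain ⟨k, r, hr, hr', rfl⟩ : ∃ k r : ℤ, 0 ≤ r ∧ r < 4 ∧ x = 4 * k + r :=
      ⟨x / 4, x % 4, by omega, by omega, by omega⟩
    rw [show (4 * k + r) ^ 2 = 8 * (2 * k ^ 2 + k * r) + r ^ 2 by ring]
    interval_cases r <;> omega
  have hM := sq M
  have hN := sq N
  omega

theorem Int.emod_two_sq (x : ℤ) : x % 2 = 0 ∧ x ^ 2 % 4 = 0 ∨ x % 2 = 1 ∧ x ^ 2 % 4 = 1 := by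
  obtain ⟨k, hk | hk⟩ := Int.even_or_odd' x
  · rw [hk, show (2 * k) ^ 2 = 4 * k ^ 2 by ring]; omega
  · rw [hk, show (2 * k + 1) ^ 2 = 4 * (k ^ 2 + k) + 1 by ring]; omega

theorem two_mul_add_emod_eight_of_sq_add_fourteen_mul_sq {p : ℕ} (hp : p.Prime)
    (hp8 : p % 8 = 1 ∨ p % 8 = 7) {M N A B : ℤ} (h : (p : ℤ) = M ^ 2 + 7 * N ^ 2)
    (hMN : M % 4 = 1 ∨ N % 4 = 1) (hAB : (p : ℤ) = A ^ 2 + 14 * B ^ 2) :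
    (2 * (p : ℤ) + M + N) % 8 = 3 := by
  have inert : ∀ A : ℤ, (p : ℤ) = A ^ 2 + 14 * B ^ 2 → ∀ q : ℕ, q.Prime →
      (q % 8 = 3 ∨ q % 8 = 5) → (q : ℤ) ∣ A + M → ¬ (q : ℤ) ∣ 2 * (A - M) := by
    intro A hAB q hq hq8 h1 h2
    have hqp := Nat.prime_iff_prime_int.1 hq
    have hq2 : ¬ (q : ℤ) ∣ 2 := fun h' => by
      have := (Nat.prime_dvd_prime_iff_eq hq Nat.prime_two).1 (by exact_mod_cast h')
      omega
    have hAd : (q : ℤ) ∣ A := by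
      have : (q : ℤ) ∣ 2 * (2 * A) := by
        rw [show 2 * (2 * A) = 2 * (A + M) + 2 * (A - M) by ring]
        exact (h1.mul_left 2).add h2
      exact ((hqp.dvd_or_dvd ((hqp.dvd_or_dvd this).resolve_left hq2)).resolve_left hq2)
    have hMd : (q : ℤ) ∣ M := (dvd_add_right hAd).1 h1
    have h7 : (q : ℤ) ∣ 7 * (N ^ 2 - 2 * B ^ 2) := by
      rw [show 7 * (N ^ 2 - 2 * B ^ 2) = A * A - M * M by linear_combination hAB - h]
      exact (hAd.mul_left _).sub (hMd.mul_left _)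
    have hq7 : ¬ (q : ℤ) ∣ 7 := fun h' => by
      have := (Nat.prime_dvd_prime_iff_eq hq (by norm_num : Nat.Prime 7)).1 (by exact_mod_cast h')
      omega
    obtain ⟨⟨n, hn⟩, -⟩ := Int.dvd_and_dvd_of_dvd_sq_sub_two_mul_sq hq hq8
      ((hqp.dvd_or_dvd h7).resolve_left hq7)
    obtain ⟨m, hm⟩ := hMd
    exact hp.not_natCast_sq_dvd hq ⟨m ^ 2 + 7 * n ^ 2, by rw [h, hm, hn]; ring⟩
  have hA2 := Int.emod_two_sq A
  have hB2 := Int.emod_two_sq B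
  rcases Int.emod_of_sq_add_seven_mul_sq (by omega) h hMN with ⟨h1, hM, hN⟩ | ⟨h1, hM, hN⟩
  -- This sign makes `A + M ≡ 2 (mod 4)`, so its half `u` is odd.
  · wlog hA : A % 4 = 1 generalizing A
    · exact this (A := -A) (by rw [hAB]; ring) (by rw [neg_sq]; omega) (by omega)
    obtain ⟨n, rfl⟩ : ∃ n, N = 4 * n := ⟨N / 4, by omega⟩
    have hA8 : A ^ 2 % 8 = 1 := by
      have := Int.sq_emod_sixteen_of_odd (x := A) (by omega)
      omega
    obtain ⟨b, rfl⟩ : ∃ b, B = 2 * b := ⟨B / 2, by omega⟩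
    obtain ⟨u, hu⟩ : ∃ u, A + M = 2 * u := ⟨(A + M) / 2, by omega⟩
    obtain ⟨w, hw⟩ : ∃ w, u - M = 2 * w := ⟨(u - M) / 2, by omega⟩
    obtain rfl : M = u - 2 * w := by omega
    obtain rfl : A = u + 2 * w := by omega
    have huw : u * w = 7 * (2 * n ^ 2 - b ^ 2) := by linarith
    have hu8 := Int.emod_eight_of_mul_eq_sq_sub_two_mul_sq u (8 * w)
      (3 * (4 * n) + 2 * (2 * b)) (4 * n + 3 * (2 * b)) (by omega)
      (by linear_combination 8 * huw)
      (fun q hq hq8 hqu hqw => inert _ hAB q hq hq8 (by rw [hu]; exact hqu.mul_left 2)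
        (by convert hqw using 1; ring))
    have := Int.add_four_mul_emod_eight (n := n) (b := b) hu8 (by rw [huw]) hM
    omega
  -- The norm is that of `(3 + √2)(N + B√2)`.
  · have hu8 := Int.emod_eight_of_mul_eq_sq_sub_two_mul_sq (A + M) (A - M)
      (3 * N + 2 * B) (N + 3 * B) (by omega)
      (by linear_combination h - hAB)
      (fun q hq hq8 hqu hqw => inert _ hAB q hq hq8 hqu (hqw.mul_left 2))
    have hA8 : A ^ 2 % 8 = 1 := by
      have := Int.sq_emod_sixteen_of_odd (x := A) (by omega)
      omega
    have := Int.add_emod_eight_eq_five (A := A) (B := B) hM hN hu8 (by omega)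
      (by rw [← hAB, ← h])
    omega

theorem two_mul_add_emod_eight_of_seven_mul_sq_add_two_mul_sq {p : ℕ} (hp : p.Prime)
    (hp8 : p % 8 = 1 ∨ p % 8 = 7) {M N C D : ℤ} (h : (p : ℤ) = M ^ 2 + 7 * N ^ 2)
    (hMN : M % 4 = 1 ∨ N % 4 = 1) (hCD : (p : ℤ) = 7 * C ^ 2 + 2 * D ^ 2) :
    (2 * (p : ℤ) + M + N) % 8 = 7 := by
  have inert : ∀ C : ℤ, (p : ℤ) = 7 * C ^ 2 + 2 * D ^ 2 → ∀ q : ℕ, q.Prime →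
      (q % 8 = 3 ∨ q % 8 = 5) → (q : ℤ) ∣ C + N → ¬ (q : ℤ) ∣ 14 * (C - N) := by
    intro C hCD q hq hq8 h1 h2
    have hqp := Nat.prime_iff_prime_int.1 hq
    have hq2 : ¬ (q : ℤ) ∣ 2 := fun h' => by
      have := (Nat.prime_dvd_prime_iff_eq hq Nat.prime_two).1 (by exact_mod_cast h')
      omega
    have hq7 : ¬ (q : ℤ) ∣ 7 := fun h' => by
      have := (Nat.prime_dvd_prime_iff_eq hq (by norm_num : Nat.Prime 7)).1 (by exact_mod_cast h')
      omega
    have hNd : (q : ℤ) ∣ N := by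
      have : (q : ℤ) ∣ 2 * (2 * (7 * N)) := by
        rw [show 2 * (2 * (7 * N)) = 14 * (C + N) - 14 * (C - N) by ring]
        exact (h1.mul_left 14).sub h2
      exact (hqp.dvd_or_dvd ((hqp.dvd_or_dvd ((hqp.dvd_or_dvd this).resolve_left hq2)).resolve_left
        hq2)).resolve_left hq7
    have hd : (q : ℤ) ∣ M ^ 2 - 2 * D ^ 2 := by
      rw [show M ^ 2 - 2 * D ^ 2 = (C + N) * (7 * (C - N)) by linear_combination hCD - h]
      exact h1.mul_right _
    obtain ⟨⟨m, hm⟩, -⟩ := Int.dvd_and_dvd_of_dvd_sq_sub_two_mul_sq hq hq8 hd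
    obtain ⟨n, hn⟩ := hNd
    exact hp.not_natCast_sq_dvd hq ⟨m ^ 2 + 7 * n ^ 2, by rw [h, hm, hn]; ring⟩
  have hC2 := Int.emod_two_sq C
  have hD2 := Int.emod_two_sq D
  rcases Int.emod_of_sq_add_seven_mul_sq (by omega) h hMN with ⟨h1, hM, hN⟩ | ⟨h1, hM, hN⟩
  · have hu8 := Int.emod_eight_of_mul_eq_sq_sub_two_mul_sq (C + N) (7 * (C - N)) M D (by omega)
      (by linear_combination h - hCD)
      (fun q hq hq8 hqu hqw => inert _ hCD q hq hq8 hqu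
        (by rw [show 14 * (C - N) = 2 * (7 * (C - N)) by ring]; exact hqw.mul_left 2))
    have hC8 : C ^ 2 % 8 = 1 := by
      have := Int.sq_emod_sixteen_of_odd (x := C) (by omega)
      omega
    -- Multiplying both representations by 7, with `49 ≡ 1 (mod 16)`, swaps the roles of `M` and
    -- `N`.
    have := Int.add_emod_eight_eq_five (A := C) (B := D) hN hM hu8 (by omega)
      (by unfold Int.ModEq; omega)
    omega
  · wlog hC : C % 4 = 1 generalizing C
    · exact this (C := -C) (by rw [hCD]; ring) (by rw [neg_sq]; omega) (by omega)
    obtain ⟨m, rfl⟩ : ∃ m, M = 4 * m := ⟨M / 4, by omega⟩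
    have hC8 : C ^ 2 % 8 = 1 := by
      have := Int.sq_emod_sixteen_of_odd (x := C) (by omega)
      omega
    obtain ⟨d, rfl⟩ : ∃ d, D = 2 * d := ⟨D / 2, by omega⟩
    obtain ⟨u, hu⟩ : ∃ u, C + N = 2 * u := ⟨(C + N) / 2, by omega⟩
    obtain ⟨w, hw⟩ : ∃ w, u - N = 2 * w := ⟨(u - N) / 2, by omega⟩
    obtain rfl : N = u - 2 * w := by omega
    obtain rfl : C = u + 2 * w := by omega
    have huw : 7 * (u * w) = 2 * m ^ 2 - d ^ 2 := by linarith
    have hu8 := Int.emod_eight_of_mul_eq_sq_sub_two_mul_sq u (56 * w)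
      (4 * m) (2 * d) (by omega) (by linear_combination 8 * huw)
      (fun q hq hq8 hqu hqw => inert _ hCD q hq hq8 (by rw [hu]; exact hqu.mul_left 2)
        (by rwa [show 14 * (u + 2 * w - (u - 2 * w)) = 56 * w by ring]))
    have := Int.add_four_mul_emod_eight (n := m) (b := d) hu8
      (by unfold Int.ModEq; omega) hN
    omega

theorem mainTheorem10 (p : ℕ) (hp : p.Prime) (hp8 : (p : ℤ) ≡ 1 [ZMOD 8] ∨ (p : ℤ) ≡ -1 [ZMOD 8])
    (M N : ℤ) (hpMN : (p : ℤ) = M ^ 2 + 7 * N ^ 2)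
    (hMN : M ≡ 1 [ZMOD 4] ∨ N ≡ 1 [ZMOD 4]) :
    ((∃ A B : ℤ, (p : ℤ) = A ^ 2 + 14 * B ^ 2) ↔ 2 * (p : ℤ) + M + N ≡ 3 [ZMOD 8]) ∧
    ((∃ C D : ℤ, (p : ℤ) = 7 * C ^ 2 + 2 * D ^ 2) ↔ 2 * (p : ℤ) + M + N ≡ 7 [ZMOD 8]) := by
  unfold Int.ModEq at *
  have hp8' : p % 8 = 1 ∨ p % 8 = 7 := by omega
  have hMN' : M % 4 = 1 ∨ N % 4 = 1 := by omega
  have ha : (∃ A B : ℤ, (p : ℤ) = A ^ 2 + 14 * B ^ 2) → (2 * (p : ℤ) + M + N) % 8 = 3 :=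
    fun ⟨_, _, h⟩ => two_mul_add_emod_eight_of_sq_add_fourteen_mul_sq hp hp8' hpMN hMN' h
  have hb : (∃ C D : ℤ, (p : ℤ) = 7 * C ^ 2 + 2 * D ^ 2) → (2 * (p : ℤ) + M + N) % 8 = 7 :=
    fun ⟨_, _, h⟩ => two_mul_add_emod_eight_of_seven_mul_sq_add_two_mul_sq hp hp8' hpMN hMN' h
  have hab := exists_sq_add_fourteen_mul_sq_or hp hp8' hpMN
  refine ⟨⟨ha, fun h => hab.resolve_right fun h' => ?_⟩,
    ⟨hb, fun h => hab.resolve_left fun h' => ?_⟩⟩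
  · have := hb h'
    omega
  · have := ha h'
    omega
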